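/- Let $\pi$ be a discrete group such that (1) the centraliser of every nontrivial element $g\in\pi$ is cyclic and (2) $\mathrm{cd}(\pi\times\pi)>\mathrm{cd}(\pi)$, where $\mathrm{cd}(G)\in\{0,1,2,\dots\}\cup\{\infty\}$ denotes the cohomological dimension of a group $G$, i.e. the supremum of all $n$ with $H^n(G,A)\neq 0$ for some $\mathbf Z[G]$-module $A$. (For example, $\pi$ may be the fundamental group of a connected aspherical finite cell complex satisfying (1) and (2).) View the group ring $\mathbf Z[\pi]$ as a left $\mathbf Z[\pi\times\pi]$-module via $(g,h)\cdot a=gah^{-1}$, let $I=\ker(\epsilon:\mathbf Z[\pi]\to\mathbf Z)$ be the augmentation ideal, and for $k\ge 0$ let $I^k=I\otimes_{\mathbf Z}\cdots\otimes_{\mathbf Z}I$ ($k$ factors, $I^0=\mathbf Z$) with the diagonal action of $\pi\times\pi$. Let $\mathfrak v\in H^1(\pi\times\pi,I)$ be the canonical class, i.e. the class of the extension $0\to I\to\mathbf Z[\pi]\xrightarrow{\epsilon}\mathbf Z\to 0$, represented by the crossed homomorphism $(g,h)\mapsto gh^{-1}-1$, and let $\mathfrak v^k\in H^k(\pi\times\pi,I^k)$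 be its $k$-fold cup power ($\mathfrak v^0=1$). Then $n=\mathrm{cd}(\pi\times\pi)$ is finite and $$\mathfrak v^{\,n-1}\neq 0\in H^{n-1}(\pi\times\pi,I^{n-1}).$$ -/

import Mathlib

noncomputable section

universe u

namespace CanonicalClass

open CategoryTheory MonoidalCategory TensorProduct

/-- The cohomological dimension of a group `G` (over `ℤ`): the supremum, in `ℕ∞`, of the degrees
`n` such that `Hⁿ(G, A) ≠ 0` for some `ℤ[G]`-module `A`. -/
def cd (G : Type) [Group G] : ℕ∞ :=
  sSup {d : ℕ∞ | ∃ n : ℕ, d = n ∧ ∃ A : Rep.{0} ℤ G, Nontrivial (groupCohomology A n)}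

section Cup

variable {k G : Type u} [CommRing k] [Group G] {A B : Rep.{u} k G} {p q : ℕ}

/-- The cup product of inhomogeneous cochains,
`(f ∪ g)(x₁, …, x_{p+q}) = f(x₁, …, x_p) ⊗ (x₁ ⋯ x_p) • g(x_{p+1}, …, x_{p+q})`,
with the diagonal action on `A ⊗ B`. -/
def cupCochain (f : (Fin p → G) → A) (g : (Fin q → G) → B) :
    (Fin (p + q) → G) → (A ⊗ B : Rep.{u} k G) :=
  fun x => f (fun i => x (Fin.castAdd q i)) ⊗ₜ[k]
    B.ρ (Fin.partialProd (fun i => x (Fin.castAdd q i)) (Fin.last p))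
      (g fun j => x (Fin.natAdd p j))

theorem cupCochain_zero_left (g : (Fin q → G) → B) (x : Fin (p + q) → G) :
    cupCochain (fun _ : Fin p → G => (0 : A)) g x = 0 :=
  TensorProduct.zero_tmul _ _

theorem cupCochain_zero_right (f : (Fin p → G) → A) (x : Fin (p + q) → G) :
    cupCochain f (fun _ : Fin q → G => (0 : B)) x = 0 := by
  unfold cupCochain
  rw [map_zero]
  exact TensorProduct.tmul_zero _ _

theorem head_contract_castAdd (x : Fin (p + q + 1) → G) (j : Fin p) :
    (fun i : Fin p => Fin.contractNth (Fin.castAdd (q + 1) j : Fin (p + q + 1)) (· * ·) x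
      (Fin.castAdd q i)) =
    Fin.contractNth j.castSucc (· * ·)
      (fun i : Fin (p + 1) => x (Fin.cast (by omega) (Fin.castAdd q i))) := by
  funext i
  rcases lt_trichotomy (i : ℕ) j with h | h | h
  · rw [Fin.contractNth_apply_of_lt _ _ _ _ (by simpa using h),
      Fin.contractNth_apply_of_lt _ _ _ _ (by simpa using h)]; rfl
  · rw [Fin.contractNth_apply_of_eq _ _ _ _ (by simpa using h),
      Fin.contractNth_apply_of_eq _ _ _ _ (by simpa using h)]; rfl
  · rw [Fin.contractNth_apply_of_gt _ _ _ _ (by simpa using h),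
      Fin.contractNth_apply_of_gt _ _ _ _ (by simpa using h)]; rfl

theorem tail_contract_castAdd (x : Fin (p + q + 1) → G) (j : Fin p) :
    (fun i : Fin q => Fin.contractNth (Fin.castAdd (q + 1) j : Fin (p + q + 1)) (· * ·) x
      (Fin.natAdd p i)) =
      (fun i : Fin q => x (Fin.cast (by omega) (Fin.natAdd (p + 1) i))) := by
  funext i
  rw [Fin.contractNth_apply_of_gt _ _ _ _ (by simp; omega)]
  congr 1; ext; simp; omega

theorem head_contract_natAdd (x : Fin (p + q + 1) → G) (j : Fin (q + 1)) :
    (fun i : Fin p => Fin.contractNth (Fin.natAdd p j : Fin (p + q + 1)) (· * ·) x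
      (Fin.castAdd q i)) =
    (fun i : Fin p => x (Fin.castAdd (q + 1) i)) := by
  funext i
  rw [Fin.contractNth_apply_of_lt _ _ _ _ (by simp; omega)]
  rfl

theorem tail_contract_natAdd (x : Fin (p + q + 1) → G) (j : Fin (q + 1)) :
    (fun i : Fin q => Fin.contractNth (Fin.natAdd p j : Fin (p + q + 1)) (· * ·) x
      (Fin.natAdd p i)) =
    Fin.contractNth j (· * ·) (fun i : Fin (q + 1) => x (Fin.natAdd p i)) := by
  funext i
  rcases lt_trichotomy (i : ℕ) j with h | h | h
  · rw [Fin.contractNth_apply_of_lt _ _ _ _ (by simpa using h),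
      Fin.contractNth_apply_of_lt _ _ _ _ (by simpa using h)]; rfl
  · rw [Fin.contractNth_apply_of_eq _ _ _ _ (by simpa using h),
      Fin.contractNth_apply_of_eq _ _ _ _ (by simpa using h)]; rfl
  · rw [Fin.contractNth_apply_of_gt _ _ _ _ (by simpa using h),
      Fin.contractNth_apply_of_gt _ _ _ _ (by simpa using h)]; rfl

/-- The Leibniz rule `d(f ∪ g) = df ∪ g + (-1)ᵖ f ∪ dg`. -/
theorem cupCochain_d (f : (Fin p → G) → A) (g : (Fin q → G) → B)
    (x : Fin (p + q + 1) → G) :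
    inhomogeneousCochains.d (A ⊗ B) (p + q) (cupCochain f g) x =
      cupCochain (inhomogeneousCochains.d A p f) g
          (fun i => x (Fin.cast (by omega) i)) +
        (-1 : k) ^ p • cupCochain (q := q + 1) f (inhomogeneousCochains.d B q g) x := by
  have key : ∀ j : Fin p, cupCochain f g (Fin.contractNth (Fin.castAdd (q + 1) j : Fin (p + q + 1)) (· * ·) x) =
      f (Fin.contractNth j.castSucc (· * ·)
      (fun i : Fin (p + 1) => x (Fin.cast (by omega) (Fin.castAdd q i)))) ⊗ₜ[k]
        B.ρ (Fin.partialProd (fun i : Fin (p + 1) => x (Fin.cast (by omega) (Fin.castAdd q i))) (Fin.last (p + 1)))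
        (g (fun i : Fin q => x (Fin.cast (by omega) (Fin.natAdd (p + 1) i)))) := by
    intro j
    unfold cupCochain
    rw [head_contract_castAdd, tail_contract_castAdd, Fin.partialProd_contractNth, Function.comp_apply,
      show j.castSucc.succ.succAbove (Fin.last p) = Fin.last (p + 1) from
        Fin.succAbove_ne_last_last (by simp [Fin.ext_iff]; omega)]
  have keyB : ∀ j : Fin (q + 1), cupCochain f g (Fin.contractNth (Fin.natAdd p j : Fin (p + q + 1)) (· * ·) x) =
      f (fun i : Fin p => x (Fin.castAdd (q + 1) i)) ⊗ₜ[k]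
        B.ρ (Fin.partialProd (fun i : Fin p => x (Fin.castAdd (q + 1) i)) (Fin.last p))
        (g (Fin.contractNth j (· * ·) (fun i : Fin (q + 1) => x (Fin.natAdd p i)))) := by
    intro j
    unfold cupCochain
    rw [head_contract_natAdd, tail_contract_natAdd]
  rw [inhomogeneousCochains.d_hom_apply]
  rw [show (∑ j : Fin (p + q + 1), (-1 : k) ^ ((j : ℕ) + 1) •
      cupCochain f g (Fin.contractNth j (· * ·) x)) = _ from
      Fin.sum_univ_add (a := p) (b := q + 1) (fun j : Fin (p + (q + 1)) => (-1 : k) ^ ((j : ℕ) + 1) •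
      cupCochain f g (Fin.contractNth j (· * ·) x))]
  simp only [key, keyB]
  have h0 : (A ⊗ B : Rep.{u} k G).ρ (x 0) (cupCochain f g fun i => x i.succ) =
      A.ρ (x 0) (f fun i : Fin p => x (Fin.cast (by omega) (Fin.castAdd q i.succ))) ⊗ₜ[k]
        B.ρ (Fin.partialProd (fun i : Fin (p + 1) => x (Fin.cast (by omega) (Fin.castAdd q i))) (Fin.last (p + 1)))
        (g (fun i : Fin q => x (Fin.cast (by omega) (Fin.natAdd (p + 1) i)))) := by
    unfold cupCochain
    rw [← Fin.succ_last, Fin.partialProd_succ', map_mul]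
    have e : (fun j : Fin q => x (Fin.natAdd p j).succ) = (fun i : Fin q => x (Fin.cast (by omega) (Fin.natAdd (p + 1) i))) := by
      funext i; congr 1; ext; simp; omega
    rw [e]
    rfl
  have h1 : cupCochain (inhomogeneousCochains.d A p f) g (fun i => x (Fin.cast (by omega) i)) =
     (inhomogeneousCochains.d A p f) (fun i : Fin (p + 1) => x (Fin.cast (by omega) (Fin.castAdd q i))) ⊗ₜ[k]
        B.ρ (Fin.partialProd (fun i : Fin (p + 1) => x (Fin.cast (by omega) (Fin.castAdd q i))) (Fin.last (p + 1)))
        (g (fun i : Fin q => x (Fin.cast (by omega) (Fin.natAdd (p + 1) i)))) := rfl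
  have h2 : cupCochain (q := q + 1) f (inhomogeneousCochains.d B q g) x = 
      f (fun i : Fin p => x (Fin.castAdd (q + 1) i)) ⊗ₜ[k]
        B.ρ (Fin.partialProd (fun i : Fin p => x (Fin.castAdd (q + 1) i)) (Fin.last p))
        (inhomogeneousCochains.d B q g (fun i : Fin (q + 1) => x (Fin.natAdd p i))) := rfl
  have h3 : Fin.contractNth (Fin.last p) (· * ·) (fun i : Fin (p + 1) => x (Fin.cast (by omega) (Fin.castAdd q i)))
      = (fun i : Fin p => x (Fin.castAdd (q + 1) i)) := by
    funext i
    rw [Fin.contractNth_apply_of_lt _ _ _ _ (by simp)]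
    rfl
  have h4 : (fun i : Fin q => x (Fin.natAdd p i.succ)) =
      (fun i : Fin q => x (Fin.cast (by omega) (Fin.natAdd (p + 1) i))) := by
    funext i; congr 1; ext; simp; omega
  have h5 : Fin.partialProd (fun i : Fin (p + 1) => x (Fin.cast (by omega) (Fin.castAdd q i))) (Fin.last (p + 1))
      = Fin.partialProd (fun i : Fin p => x (Fin.castAdd (q + 1) i)) (Fin.last p) * x (Fin.natAdd p (0 : Fin (q + 1))) := by
    rw [← Fin.succ_last, Fin.partialProd_succ, ← Fin.partialProd_init]
    rfl
  rw [h0, h1, h2, inhomogeneousCochains.d_hom_apply, inhomogeneousCochains.d_hom_apply,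
    Fin.sum_univ_castSucc (n := p), h3, h4]
  simp only [TensorProduct.add_tmul, TensorProduct.tmul_add, map_add, map_sum,
    TensorProduct.sum_tmul, TensorProduct.tmul_sum, map_smul, TensorProduct.tmul_smul,
    ← TensorProduct.smul_tmul', h5, map_mul, Module.End.mul_apply, Fin.val_castAdd,
    Fin.val_natAdd, Fin.val_castSucc, Fin.val_last]
  have h6 : ∀ (S : Fin (q + 1) → (A ⊗ B : Rep.{u} k G)),
      ∑ j : Fin (q + 1), (-1 : k) ^ (p + (j : ℕ) + 1) • S j =
        (-1 : k) ^ p • ∑ j : Fin (q + 1), (-1 : k) ^ ((j : ℕ) + 1) • S j := by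
    intro S
    rw [Finset.smul_sum]
    refine Finset.sum_congr rfl fun j _ => ?_
    rw [smul_smul, ← pow_add, add_assoc]
  have h7 : ∀ a b c e : (A ⊗ B : Rep.{u} k G),
      a + (b + (-1 : k) ^ p • c) = a + (b + (-1 : k) ^ (p + 1) • e) + (-1 : k) ^ p • (e + c) := by
    intro a b c e
    rw [pow_succ, mul_neg_one, neg_smul, smul_add]
    abel
  exact (congrArg _ (congrArg _ (h6 _))).trans (h7 _ _ _ _)

theorem d_cupCochain_eq_zero (f : (Fin p → G) → A) (g : (Fin q → G) → B)
    (hf : inhomogeneousCochains.d A p f = 0) (hg : inhomogeneousCochains.d B q g = 0) :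
    inhomogeneousCochains.d (A ⊗ B) (p + q) (cupCochain f g) = 0 := by
  funext x
  rw [cupCochain_d, hf, hg]
  exact (congrArg₂ _ (cupCochain_zero_left _ _)
    ((congrArg _ (cupCochain_zero_right _ _)).trans (smul_zero _))).trans (add_zero _)

/-- The cochain underlying a cocycle. -/
def cochain (a : groupCohomology.cocycles A p) : (Fin p → G) → A :=
  groupCohomology.iCocycles A p a

theorem d_cochain (a : groupCohomology.cocycles A p) :
    inhomogeneousCochains.d A p (cochain a) = 0 := by
  have := ConcreteCategory.congr_hom
    ((groupCohomology.inhomogeneousCochains A).iCycles_d p (p + 1)) a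
  rw [groupCohomology.inhomogeneousCochains.d_def] at this
  exact this

theorem cochain_mk (f : (Fin p → G) → A) (h : inhomogeneousCochains.d A p f = 0) :
    cochain (groupCohomology.cocyclesMk f h) = f :=
  groupCohomology.iCocycles_mk f h

theorem cochain_injective : Function.Injective (cochain (A := A) (p := p)) :=
  (ModuleCat.mono_iff_injective (groupCohomology.iCocycles A p)).1 inferInstance

/-- A cocycle has zero class iff it is a coboundary (zero in degree `0`). -/
theorem π_eq_zero_iff (a : groupCohomology.cocycles A p) :
    groupCohomology.π A p a = 0 ↔ a = 0 ∨ ∃ m, ∃ hm : m + 1 = p, ∃ h : (Fin m → G) → A,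
      ∀ x, cochain a x = inhomogeneousCochains.d A m h (fun i => x (Fin.cast hm i)) := by
  have ex : ∀ i, (ComplexShape.up ℕ).prev p = i → (groupCohomology.π A p a = 0 ↔
      ∃ h, groupCohomology.toCocycles A i p h = a) := by
    intro i hi
    have h1 : (ShortComplex.mk (groupCohomology.toCocycles A i p) (groupCohomology.π A p)
        (by exact HomologicalComplex.toCycles_comp_homologyπ _ _ _)).Exact :=
      ShortComplex.exact_of_g_is_cokernel _ (HomologicalComplex.homologyIsCokernel _ _ _ hi)
    rw [ShortComplex.moduleCat_exact_iff] at h1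
    refine ⟨fun h => h1 a h, ?_⟩
    rintro ⟨h, rfl⟩
    exact ConcreteCategory.congr_hom (HomologicalComplex.toCycles_comp_homologyπ
      (groupCohomology.inhomogeneousCochains A) i p) h
  have hd : ∀ i (h : (groupCohomology.inhomogeneousCochains A).X i),
      cochain (groupCohomology.toCocycles A i p h) =
        (groupCohomology.inhomogeneousCochains A).d i p h := fun i h =>
    ConcreteCategory.congr_hom (HomologicalComplex.toCycles_i
      (groupCohomology.inhomogeneousCochains A) i p) h
  cases p with
  | zero =>
    rw [ex 0 (by simp)]
    constructor
    · rintro ⟨h, rfl⟩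
      refine Or.inl (cochain_injective ?_)
      rw [hd, HomologicalComplex.shape _ _ _ (by simp)]
      exact (map_zero (groupCohomology.iCocycles A 0).hom).symm
    · rintro (rfl | ⟨m, hm, -⟩)
      · exact ⟨0, map_zero _⟩
      · omega
  | succ p =>
    rw [ex p (by simp)]
    constructor
    · rintro ⟨h, rfl⟩
      refine Or.inr ⟨p, rfl, h, fun x => ?_⟩
      rw [hd, groupCohomology.inhomogeneousCochains.d_def]
      rfl
    · rintro (rfl | ⟨m, hm, h, H⟩)
      · exact ⟨0, map_zero _⟩
      obtain rfl : m = p := by omega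
      refine ⟨h, cochain_injective ?_⟩
      rw [hd, groupCohomology.inhomogeneousCochains.d_def]
      exact (funext H).symm

/-- The cup product of two cocycles. -/
def cupCocycle (a : groupCohomology.cocycles A p) (b : groupCohomology.cocycles B q) :
    groupCohomology.cocycles (A ⊗ B) (p + q) :=
  groupCohomology.cocyclesMk (cupCochain (cochain a) (cochain b))
    (d_cupCochain_eq_zero _ _ (d_cochain a) (d_cochain b))

theorem π_surjective : Function.Surjective (groupCohomology.π A p) :=
  fun y => groupCohomology_induction_on y fun x => ⟨x, rfl⟩

/-- The cup product `Hᵖ(G, A) × H^q(G, B) → H^{p+q}(G, A ⊗ B)`, computed on representing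
cocycles; by `cup_π` it does not depend on the representatives. -/
def cup (a : groupCohomology A p) (b : groupCohomology B q) :
    groupCohomology (A ⊗ B) (p + q) :=
  groupCohomology.π (A ⊗ B) (p + q)
    (cupCocycle (Function.surjInv π_surjective a) (Function.surjInv π_surjective b))

theorem π_cupCocycle_left (a : groupCohomology.cocycles A p) (b : groupCohomology.cocycles B q)
    (ha : groupCohomology.π A p a = 0) :
    groupCohomology.π (A ⊗ B) (p + q) (cupCocycle a b) = 0 := by
  rw [π_eq_zero_iff] at ha ⊢
  rcases ha with rfl | ⟨m, rfl, h, H⟩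
  · refine Or.inl (cochain_injective ?_)
    rw [cupCocycle, cochain_mk]
    funext x
    have h0 : ∀ {C : Rep.{u} k G} {r : ℕ} (y : Fin r → G),
      cochain (0 : groupCohomology.cocycles C r) y = 0 := fun {C r} y =>
        congrFun (map_zero (groupCohomology.iCocycles C r).hom) y
    rw [h0, cupCochain, h0]
    exact TensorProduct.zero_tmul _ _
  · refine Or.inr ⟨m + q, by omega, cupCochain h (cochain b), fun x => ?_⟩
    rw [cupCocycle, cochain_mk, cupCochain_d, d_cochain]
    have : cochain a = inhomogeneousCochains.d A m h := funext H
    rw [this]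
    refine (add_zero _).symm.trans (congrArg₂ _ rfl ?_)
    exact ((congrArg _ (cupCochain_zero_right _ _)).trans (smul_zero _)).symm

theorem π_cupCocycle_right (a : groupCohomology.cocycles A p) (b : groupCohomology.cocycles B q)
    (hb : groupCohomology.π B q b = 0) :
    groupCohomology.π (A ⊗ B) (p + q) (cupCocycle a b) = 0 := by
  rw [π_eq_zero_iff] at hb ⊢
  rcases hb with rfl | ⟨m, rfl, h, H⟩
  · refine Or.inl (cochain_injective ?_)
    rw [cupCocycle, cochain_mk]
    funext x
    have h0 : ∀ {C : Rep.{u} k G} {r : ℕ} (y : Fin r → G),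
      cochain (0 : groupCohomology.cocycles C r) y = 0 := fun {C r} y =>
        congrFun (map_zero (groupCohomology.iCocycles C r).hom) y
    rw [h0, cupCochain, h0, map_zero]
    exact TensorProduct.tmul_zero _ _
  · refine Or.inr ⟨p + m, by omega, (-1 : k) ^ p • cupCochain (cochain a) h, fun x => ?_⟩
    have : cochain b = inhomogeneousCochains.d B m h := funext H
    rw [cupCocycle, cochain_mk, this]
    have e := congrFun (map_smul (inhomogeneousCochains.d (A ⊗ B) (p + m)).hom ((-1 : k) ^ p)
      (cupCochain (cochain a) h)) x
    refine Eq.trans ?_ e.symm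
    change _ = (-1 : k) ^ p • (inhomogeneousCochains.d (A ⊗ B) (p + m)) _ x
    rw [cupCochain_d, d_cochain, smul_add, smul_smul, ← mul_pow, neg_one_mul, neg_neg, one_pow,
      one_smul]
    refine (zero_add _).symm.trans (congrArg₂ _ ?_ rfl)
    exact ((congrArg _ (cupCochain_zero_left _ _)).trans (smul_zero _)).symm

theorem cup_π (a : groupCohomology.cocycles A p) (b : groupCohomology.cocycles B q) :
    cup (groupCohomology.π A p a) (groupCohomology.π B q b) =
      groupCohomology.π (A ⊗ B) (p + q) (cupCocycle a b) := by
  unfold cup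
  set a₁ := Function.surjInv π_surjective (groupCohomology.π A p a)
  set b₁ := Function.surjInv π_surjective (groupCohomology.π B q b)
  have ha : groupCohomology.π A p (a₁ - a) = 0 := by
    rw [map_sub, sub_eq_zero]; exact Function.surjInv_eq π_surjective _
  have hb : groupCohomology.π B q (b₁ - b) = 0 := by
    rw [map_sub, sub_eq_zero]; exact Function.surjInv_eq π_surjective _
  have hs : ∀ {C : Rep.{u} k G} {r : ℕ} (y z : groupCohomology.cocycles C r) (t : Fin r → G),
      cochain (y - z) t = cochain y t - cochain z t := fun {C r} y z t =>
        congrFun (map_sub (groupCohomology.iCocycles C r).hom y z) t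
  have key : cupCocycle a₁ b₁ - cupCocycle a b = cupCocycle (a₁ - a) b₁ + cupCocycle a (b₁ - b) := by
    apply cochain_injective
    funext x
    rw [hs]
    refine Eq.trans ?_ (congrFun (map_add (groupCohomology.iCocycles (A ⊗ B) (p + q)).hom _ _) x).symm
    change _ = cochain (cupCocycle (a₁ - a) b₁) x + cochain (cupCocycle a (b₁ - b)) x
    simp only [cupCocycle, cochain_mk, cupCochain, hs, map_sub, TensorProduct.sub_tmul, TensorProduct.tmul_sub]
    exact (sub_add_sub_cancel _ _ _).symm
  rw [← sub_eq_zero, ← map_sub, key, map_add, π_cupCocycle_left _ _ ha, π_cupCocycle_right _ _ hb,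
    add_zero]

end Cup


section Canonical

variable (π : Type) [Group π]

/-- The action `(g, h) • a = g a h⁻¹` of `π × π` on the set `π`. -/
abbrev twoSidedAction : MulAction (π × π) π where
  smul x a := x.1 * a * x.2⁻¹
  one_smul a := by change 1 * a * 1⁻¹ = a; group
  mul_smul x y a := by
    change x.1 * y.1 * a * (x.2 * y.2)⁻¹ = x.1 * (y.1 * a * y.2⁻¹) * x.2⁻¹
    group

/-- The group ring `ℤ[π]` as a `ℤ[π × π]`-module, `(g, h) • a = g a h⁻¹`. -/
abbrev groupRing : Rep.{0} ℤ (π × π) :=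
  letI := twoSidedAction π
  Rep.ofMulAction ℤ (π × π) π

/-- The augmentation `ε : ℤ[π] → ℤ`, the sum of the coefficients. -/
def augmentation : MonoidAlgebra ℤ π →ₗ[ℤ] ℤ :=
  (MonoidAlgebra.lift ℤ ℤ π (1 : π →* ℤ)).toLinearMap

theorem groupRing_single (x : π × π) (a : π) (r : ℤ) :
    (groupRing π).ρ x (MonoidAlgebra.single a r) =
      MonoidAlgebra.single (x.1 * a * x.2⁻¹) r := by
  let _ := twoSidedAction π
  exact Representation.ofMulAction_single x a r

theorem augmentation_ρ (x : π × π) (m : MonoidAlgebra ℤ π) :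
    augmentation π ((groupRing π).ρ x m) = augmentation π m := by
  induction m using MonoidAlgebra.induction_linear with
  | zero => simp
  | add f g hf hg => rw [map_add, map_add, map_add, hf, hg]
  | single a r => rw [groupRing_single]; simp [augmentation]

/-- The augmentation ideal `I = ker ε` as a `ℤ[π × π]`-submodule of `ℤ[π]`. -/
def augIdeal : Rep.{0} ℤ (π × π) :=
  Rep.subrepresentation (groupRing π) (LinearMap.ker (augmentation π)) fun x m hm => by
    rw [Submodule.mem_comap, LinearMap.mem_ker, augmentation_ρ]; exact hm

/-- The tensor powers `Iⁿ = I ⊗ ⋯ ⊗ I` over `ℤ` with the diagonal action; `I⁰ = ℤ`. -/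
def augIdealPow : ℕ → Rep.{0} ℤ (π × π)
  | 0 => 𝟙_ (Rep.{0} ℤ (π × π))
  | n + 1 => augIdealPow n ⊗ augIdeal π

/-- The crossed homomorphism `(g, h) ↦ gh⁻¹ - 1` from `π × π` to `I`. -/
def canonicalCochain (x : Fin 1 → π × π) : augIdeal π :=
  ⟨MonoidAlgebra.single ((x 0).1 * (x 0).2⁻¹) 1 - MonoidAlgebra.single 1 1, by
    simp [augmentation]⟩

theorem d_canonicalCochain :
    inhomogeneousCochains.d (augIdeal π) 1 (canonicalCochain π) = 0 := by
  funext x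
  rw [inhomogeneousCochains.d_hom_apply]
  apply Subtype.ext
  have hρ : ((augIdeal π).ρ (x 0) (canonicalCochain π fun i => x i.succ)).1 =
      MonoidAlgebra.single ((x 0).1 * ((x 1).1 * (x 1).2⁻¹) * (x 0).2⁻¹) 1 -
        MonoidAlgebra.single ((x 0).1 * 1 * (x 0).2⁻¹) 1 := by
    rw [← groupRing_single π (x 0), ← groupRing_single π (x 0), ← map_sub]
    rfl
  have h0 : (canonicalCochain π (Fin.contractNth 0 (· * ·) x)).1 =
      MonoidAlgebra.single ((x 0).1 * ((x 1).1 * (x 1).2⁻¹) * (x 0).2⁻¹) 1 -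
        MonoidAlgebra.single 1 1 := by
    rw [show (x 0).1 * ((x 1).1 * (x 1).2⁻¹) * (x 0).2⁻¹ =
      (x 0).1 * (x 1).1 * ((x 0).2 * (x 1).2)⁻¹ by group]
    rfl
  have h1 : (canonicalCochain π (Fin.contractNth 1 (· * ·) x)).1 =
      MonoidAlgebra.single ((x 0).1 * 1 * (x 0).2⁻¹) 1 - MonoidAlgebra.single 1 1 := by
    rw [mul_one]
    rfl
  rw [Fin.sum_univ_two]
  simp only [Fin.val_zero, Fin.val_one, zero_add, pow_one, one_add_one_eq_two, neg_one_sq,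
    neg_smul]
  erw [one_smul ℤ, one_smul ℤ]
  change _ + (-(canonicalCochain π (Fin.contractNth 0 (· * ·) x)).1 +
    (canonicalCochain π (Fin.contractNth 1 (· * ·) x)).1) = 0
  rw [h0, h1]
  refine (congrArg (· + _) hρ).trans ?_
  abel

/-- The canonical class `𝔳 ∈ H¹(π × π, I)`, the class of the extension `0 → I → ℤ[π] → ℤ → 0`:
in the bar resolution it is represented by the crossed homomorphism `(g, h) ↦ gh⁻¹ - 1`. -/
def canonicalClass : groupCohomology (augIdeal π) 1 :=
  groupCohomology.π (augIdeal π) 1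
    (groupCohomology.cocyclesMk (canonicalCochain π) (d_canonicalCochain π))

/-- The unit `1 ∈ H⁰(G, ℤ)`. -/
def unitClass (G : Type) [Group G] : groupCohomology (𝟙_ (Rep.{0} ℤ G)) 0 :=
  groupCohomology.π _ 0 (groupCohomology.cocyclesMk (fun _ => (1 : ℤ)) (by
    funext x
    rw [inhomogeneousCochains.d_hom_apply]
    simp
    rfl))

/-- The cup powers `𝔳ⁿ ∈ Hⁿ(π × π, Iⁿ)`, with `𝔳⁰ = 1` and `𝔳ⁿ⁺¹ = 𝔳ⁿ ∪ 𝔳`. -/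
def canonicalClassPow : (n : ℕ) → groupCohomology (augIdealPow π n) n
  | 0 => unitClass (π × π)
  | n + 1 => cup (canonicalClassPow n) (canonicalClass π)

end Canonical

end CanonicalClass

end

/-!
Since `Hom(ℤ[π], A)` is a product of modules coinduced from conjugates of the diagonal `π`, its
cohomology over `π × π` vanishes above `cd π`. A basis of `ℤ[π] ⊗ I` is permuted by `π × π` with
stabilisers embedding in centralisers of nontrivial elements, so the cohomology of
`Hom(ℤ[π], Hom(I, A))` vanishes above the largest dimension `m` of these centralisers. Shifting
dimension along `0 → I → ℤ[π] → ℤ → 0` therefore writes every class of degree `n > cd π` as a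
multiple of `𝔳`, then of `𝔳 ^ 2`, and so on up to `𝔳 ^ (n - m)`; in degree `n = cd (π × π)` some
class is nonzero, and so is `𝔳 ^ (n - m)`. Nontrivial finite cyclic groups have infinite dimension,
which leaves `m = 1` for cyclic centralisers. The same shifting over `G × H`, acting on `ℤ[G]` by
left translations through `G`, gives `cd (G × H) ≤ cd G + cd H` and hence the finiteness of `n`.
-/

noncomputable section

universe u

namespace CanonicalClass

open CategoryTheory MonoidalCategory TensorProduct Limits

section Cochains

variable {k G : Type u} [CommRing k] [Group G] {A B : Rep.{u} k G} {n : ℕ}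

/-- The inhomogeneous `n`-coboundaries with values in `A`; there are none but `0` in degree `0`. -/
def coboundaries (A : Rep.{u} k G) : (n : ℕ) → Submodule k ((Fin n → G) → A)
  | 0 => ⊥
  | n + 1 => LinearMap.range (inhomogeneousCochains.d A n).hom

theorem π_eq_zero_iff_mem_coboundaries (a : groupCohomology.cocycles A n) :
    groupCohomology.π A n a = 0 ↔ cochain a ∈ coboundaries A n := by
  have cochain_zero : cochain (0 : groupCohomology.cocycles A n) = 0 :=
    map_zero (groupCohomology.iCocycles A n).hom
  rw [π_eq_zero_iff, ← cochain_injective.eq_iff, cochain_zero]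
  cases n with
  | zero => exact ⟨fun h => h.elim id fun ⟨m, hm, _⟩ => absurd hm m.succ_ne_zero, Or.inl⟩
  | succ n =>
    constructor
    · rintro (h | ⟨m, hm, h, H⟩)
      · exact h ▸ zero_mem _
      · obtain rfl : m = n := Nat.succ_injective hm
        exact ⟨h, (funext H).symm⟩
    · rintro ⟨h, H⟩
      exact Or.inr ⟨n, rfl, h, fun x => congrFun H.symm x⟩

theorem isZero_groupCohomology_iff : IsZero (groupCohomology A n) ↔
    ∀ f : (Fin n → G) → A, inhomogeneousCochains.d A n f = 0 → f ∈ coboundaries A n := by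
  rw [ModuleCat.isZero_iff_subsingleton, subsingleton_iff_forall_eq 0, π_surjective.forall]
  simp only [π_eq_zero_iff_mem_coboundaries]
  refine ⟨fun h f hf => ?_, fun h a => h _ (d_cochain a)⟩
  rw [← cochain_mk f hf]
  exact h _

theorem comp_cast_mem_coboundaries {m : ℕ} (e : n = m) {f : (Fin n → G) → A} :
    (fun x : Fin m → G => f (x ∘ Fin.cast e)) ∈ coboundaries A m ↔ f ∈ coboundaries A n := by
  subst e
  rfl

variable {H : Type u} [Group H]

theorem d_map (θ : H →* G) {B : Rep.{u} k H} (φ : Rep.res θ A ⟶ B) (f : (Fin n → G) → A)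
    (x : Fin (n + 1) → H) :
    inhomogeneousCochains.d B n (fun y => φ.hom (f (θ ∘ y))) x =
      φ.hom (inhomogeneousCochains.d A n f (θ ∘ x)) := by
  rw [inhomogeneousCochains.d_hom_apply, inhomogeneousCochains.d_hom_apply, map_add, map_sum]
  congr 1
  · exact (Rep.hom_comm_apply φ (x 0) _).symm
  · refine Finset.sum_congr rfl fun j _ => ?_
    rw [map_smul]
    congr 3
    exact Fin.comp_contractNth (· * ·) (· * ·) (map_mul θ) j x

theorem d_res (θ : H →* G) (f : (Fin n → G) → A) :
    inhomogeneousCochains.d (Rep.res θ A) n (fun y => f (θ ∘ y)) =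
      fun x => inhomogeneousCochains.d A n f (θ ∘ x) :=
  funext (d_map θ (𝟙 (Rep.res θ A)) f)

theorem d_comp_hom (φ : A ⟶ B) (f : (Fin n → G) → A) :
    inhomogeneousCochains.d B n (fun y => φ.hom (f y)) =
      fun x => φ.hom (inhomogeneousCochains.d A n f x) :=
  funext (d_map (MonoidHom.id G) φ f)

theorem res_mem_coboundaries (θ : H →* G) {f : (Fin n → G) → A} (hf : f ∈ coboundaries A n) :
    (fun y => f (θ ∘ y)) ∈ coboundaries (Rep.res θ A) n := by
  cases n with
  | zero =>
    obtain rfl : f = 0 := hf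
    exact zero_mem _
  | succ n =>
    obtain ⟨h, rfl⟩ := hf
    exact ⟨fun y => h (θ ∘ y), d_res θ h⟩

theorem partialProd_map (θ : H →* G) (x : Fin n → H) (i : Fin (n + 1)) :
    Fin.partialProd (θ ∘ x) i = θ (Fin.partialProd x i) := by
  induction i using Fin.induction with
  | zero => simp
  | succ i ih => rw [Fin.partialProd_succ, Fin.partialProd_succ, ih, map_mul, Function.comp_apply]

theorem cupCochain_res (θ : H →* G) {p q : ℕ} (f : (Fin p → G) → A) (g : (Fin q → G) → B)
    (x : Fin (p + q) → H) :
    cupCochain (A := Rep.res θ A) (B := Rep.res θ B) (fun y => f (θ ∘ y)) (fun y => g (θ ∘ y)) x =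
      (cupCochain f g (θ ∘ x) : A ⊗[k] B) :=
  congrArg (fun a => f (θ ∘ x ∘ Fin.castAdd q) ⊗ₜ[k] B.ρ a (g (θ ∘ x ∘ Fin.natAdd p)))
    (partialProd_map θ (x ∘ Fin.castAdd q) (Fin.last p)).symm

theorem isZero_groupCohomology_of_mulEquiv (e : G ≃* H) (A : Rep.{u} k G)
    (h : IsZero (groupCohomology (Rep.res e.symm.toMonoidHom A) n)) :
    IsZero (groupCohomology A n) :=
  h.of_iso (groupCohomology.mapIso (A := Rep.res e.symm.toMonoidHom A) (B := A) e
    (LinearEquiv.refl k A) (fun g => by ext; simp [Rep.res]) n)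

end Cochains

section Functions

variable {k G : Type u} [CommRing k] [Group G] {n : ℕ}

theorem isZero_groupCohomology_of_jointly_bijective {ι : Type*} {A : Rep.{u} k G}
    {B : ι → Rep.{u} k G} (φ : ∀ i, A ⟶ B i)
    (hφ : Function.Bijective fun a i => (φ i).hom a)
    (hB : ∀ i, IsZero (groupCohomology (B i) n)) : IsZero (groupCohomology A n) := by
  rw [isZero_groupCohomology_iff]
  intro f hf
  have hφf : ∀ i, (fun y => (φ i).hom (f y)) ∈ coboundaries (B i) n := fun i => by
    refine isZero_groupCohomology_iff.1 (hB i) _ ?_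
    rw [d_comp_hom, hf]
    exact funext fun _ => map_zero (φ i).hom
  cases n with
  | zero =>
    exact funext fun y => hφ.1 (funext fun i =>
      (congrFun (hφf i) y).trans (map_zero (φ i).hom).symm)
  | succ n =>
    choose h hh using hφf
    choose F hF using fun y => hφ.2 fun i => h i y
    refine ⟨F, funext fun x => hφ.1 (funext fun i => ?_)⟩
    have hFi : (fun y => (φ i).hom (F y)) = h i := funext fun y => congrFun (hF y) i
    change (φ i).hom (inhomogeneousCochains.d A n F x) = (φ i).hom (f x)
    rw [← congrFun (d_comp_hom (φ i) F) x, hFi]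
    exact congrFun (hh i) x

variable {X : Type u} [MulAction G X]

/-- The `k[G]`-module of all functions `X → N`, with `(g • F)(x) = g • F(g⁻¹ • x)`; it is
`Hom(k[X], N)` without reference to linear maps. -/
def functionRep (X : Type u) [MulAction G X] (N : Rep.{u} k G) : Rep.{u} k G :=
  Rep.of (X := X → N)
    { toFun := fun g => LinearMap.pi fun x => N.ρ g ∘ₗ LinearMap.proj (g⁻¹ • x)
      map_one' := by ext; simp
      map_mul' := fun g h => by ext; simp [mul_smul] }

/-- Evaluation of functions `X → N` at the points of the orbit of `x`, as a map to the module
coinduced from the stabilizer of `x`. -/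
def orbitEval (N : Rep.{u} k G) (x : X) : functionRep X N ⟶
    Rep.coind (MulAction.stabilizer G x).subtype
      (Rep.res (MulAction.stabilizer G x).subtype N) :=
  Rep.ofHom
    { toFun := fun F => ⟨fun g => N.ρ g (F (g⁻¹ • x)), fun s g => by
        have hs : (s : G)⁻¹ • x = x := MulAction.mem_stabilizer_iff.1 (inv_mem s.2)
        change N.ρ (s * g) (F ((s * g : G)⁻¹ • x)) = N.ρ s (N.ρ g (F (g⁻¹ • x)))
        rw [map_mul, mul_inv_rev, mul_smul, hs]
        rfl⟩
      map_add' := fun F F' => Subtype.ext (funext fun g => map_add (N.ρ g) _ _)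
      map_smul' := fun r F => Subtype.ext (funext fun g => map_smul (N.ρ g) _ _)
      isIntertwining' := fun g => LinearMap.ext fun F => Subtype.ext (funext fun h => by
        change N.ρ h (N.ρ g (F (g⁻¹ • h⁻¹ • x))) = N.ρ (h * g) (F ((h * g)⁻¹ • x))
        rw [map_mul, mul_inv_rev, mul_smul]
        rfl) }

theorem orbitEval_jointly_bijective (N : Rep.{u} k G) :
    Function.Bijective fun (F : functionRep X N) (q : MulAction.orbitRel.Quotient G X) =>
      (orbitEval N q.out).hom F := by
  let _ : Setoid X := MulAction.orbitRel G X
  have hout : ∀ x : X, ∃ γ : G, γ • (⟦x⟧ : MulAction.orbitRel.Quotient G X).out = x := fun x =>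
    MulAction.orbitRel_apply.1 (Setoid.symm (Quotient.mk_out (s := MulAction.orbitRel G X) x))
  choose γ hγ using hout
  constructor
  · refine fun F F' h => funext fun x => ?_
    have hx : N.ρ (γ x)⁻¹ (F ((γ x)⁻¹⁻¹ • _)) = N.ρ (γ x)⁻¹ (F' ((γ x)⁻¹⁻¹ • _)) :=
      congrFun (congrArg Subtype.val (congrFun h ⟦x⟧)) (γ x)⁻¹
    rw [inv_inv, hγ] at hx
    exact (N.ρ.apply_bijective _).1 hx
  · intro h
    refine ⟨fun x => N.ρ (γ x) ((h ⟦x⟧).1 (γ x)⁻¹),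
      funext fun q => Subtype.ext (funext fun g => ?_)⟩
    obtain ⟨z, hz⟩ : ∃ z, z = g⁻¹ • q.out := ⟨_, rfl⟩
    have hzq : (⟦z⟧ : MulAction.orbitRel.Quotient G X) = q := by
      rw [← q.out_eq, hz]
      exact Quotient.sound ⟨g⁻¹, rfl⟩
    have hstab : g * γ z ∈ MulAction.stabilizer G q.out := by
      rw [MulAction.mem_stabilizer_iff, mul_smul, ← hzq, hγ z, hzq, hz, smul_inv_smul]
    have hcoind : (h q).1 (g * γ z * (γ z)⁻¹) = N.ρ (g * γ z) ((h q).1 (γ z)⁻¹) :=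
      (h q).2 ⟨g * γ z, hstab⟩ (γ z)⁻¹
    change N.ρ g (N.ρ (γ (g⁻¹ • q.out)) ((h ⟦g⁻¹ • q.out⟧).1 (γ (g⁻¹ • q.out))⁻¹)) = (h q).1 g
    rw [← hz, hzq, ← Module.End.mul_apply, ← map_mul, ← hcoind, mul_inv_cancel_right]

theorem isZero_groupCohomology_functionRep (N : Rep.{u} k G)
    (h : ∀ x : X, IsZero (groupCohomology (Rep.res (MulAction.stabilizer G x).subtype N) n)) :
    IsZero (groupCohomology (functionRep X N) n) :=
  isZero_groupCohomology_of_jointly_bijective _ (orbitEval_jointly_bijective N) fun q =>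
    (h q.out).of_iso (groupCohomology.coindIso _ n)

end Functions

section PermutationModules

variable {k G X : Type u} [CommRing k] [Group G] [MulAction G X] {A P J N : Rep.{u} k G} {n : ℕ}

theorem isZero_groupCohomology_of_equiv_functions (e : A ≃ₗ[k] (X → N))
    (he : ∀ g a x, e (A.ρ g a) x = N.ρ g (e a (g⁻¹ • x)))
    (h : ∀ x : X, IsZero (groupCohomology (Rep.res (MulAction.stabilizer G x).subtype N) n)) :
    IsZero (groupCohomology A n) :=
  isZero_groupCohomology_of_jointly_bijective (ι := Unit) (B := fun _ => functionRep X N)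
    (fun _ => Rep.ofHom ⟨e.toLinearMap, fun g => LinearMap.ext fun a => funext (he g a)⟩)
    ((Equiv.funUnique Unit (X → N)).symm.bijective.comp e.bijective)
    fun _ => isZero_groupCohomology_functionRep N h

theorem isZero_groupCohomology_ihom (b : Module.Basis X k P)
    (hb : ∀ g x, P.ρ g (b x) = b (g • x))
    (h : ∀ x : X, IsZero (groupCohomology (Rep.res (MulAction.stabilizer G x).subtype N) n)) :
    IsZero (groupCohomology ((Rep.ihom P).obj N) n) :=
  isZero_groupCohomology_of_equiv_functions (b.constr k).symm
    (fun g (Φ : P →ₗ[k] N) x => congrArg (fun p => N.ρ g (Φ p)) (hb g⁻¹ x)) h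

/-- The `G`-set of pairs of distinct elements of `X`. -/
def offDiag (G X : Type u) [Group G] [MulAction G X] : SubMulAction G (X × X) where
  carrier := {p | p.2 ≠ p.1}
  smul_mem' g _ hp := (MulAction.injective g).ne hp

theorem isZero_groupCohomology_ihom_ihom (b : Module.Basis X k P)
    (hb : ∀ g x, P.ρ g (b x) = b (g • x)) (c : ∀ a : X, Module.Basis {x // x ≠ a} k J)
    (hc : ∀ g (p : offDiag G X),
      J.ρ g (c p.1.1 ⟨p.1.2, p.2⟩) = c (g • p).1.1 ⟨(g • p).1.2, (g • p).2⟩)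
    (h : ∀ p : offDiag G X,
      IsZero (groupCohomology (Rep.res (MulAction.stabilizer G p).subtype N) n)) :
    IsZero (groupCohomology ((Rep.ihom P).obj ((Rep.ihom J).obj N)) n) := by
  let e : (P →ₗ[k] J →ₗ[k] N) ≃ₗ[k] (offDiag G X → N) :=
    (b.constr k).symm ≪≫ₗ
    LinearEquiv.piCongrRight (fun a => ((c a).constr k).symm) ≪≫ₗ
    (LinearEquiv.piCurry k fun (a : X) (_ : {x // x ≠ a}) => N).symm ≪≫ₗ
    LinearEquiv.funCongrLeft k N (Equiv.subtypeProdEquivSigmaSubtype fun a x : X => x ≠ a)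
  refine isZero_groupCohomology_of_equiv_functions (A := (Rep.ihom P).obj ((Rep.ihom J).obj N))
    e (fun g (Φ : P →ₗ[k] J →ₗ[k] N) p => ?_) h
  change N.ρ g (Φ (P.ρ g⁻¹ (b p.1.1)) (J.ρ g⁻¹ (c p.1.1 ⟨p.1.2, p.2⟩))) =
    N.ρ g (Φ (b (g⁻¹ • p).1.1) (c (g⁻¹ • p).1.1 ⟨(g⁻¹ • p).1.2, (g⁻¹ • p).2⟩))
  rw [hb, hc]
  rfl

end PermutationModules

section KernelBasis

variable {k M X : Type*} [CommRing k] [AddCommGroup M] [Module k M] (b : Module.Basis X k M)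
  {ε : M →ₗ[k] k} (hε : ∀ x, ε (b x) = 1)

include hε

theorem span_basis_sub_eq_ker (a : X) :
    Submodule.span k (Set.range fun x : {x // x ≠ a} => b x - b a) = LinearMap.ker ε := by
  apply le_antisymm
  · rw [Submodule.span_le]
    rintro _ ⟨x, rfl⟩
    change ε (b x - b a) = 0
    rw [map_sub, hε, hε, sub_self]
  · set S := Submodule.span k (Set.range fun x : {x // x ≠ a} => b x - b a)
    have le_comap : ⊤ ≤ S.comap (LinearMap.id - ε.smulRight (b a)) := by
      rw [← b.span_eq, Submodule.span_le]
      rintro _ ⟨x, rfl⟩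
      change b x - ε (b x) • b a ∈ S
      rw [hε, one_smul]
      by_cases hx : x = a
      · rw [hx, sub_self]
        exact S.zero_mem
      · exact Submodule.subset_span ⟨⟨x, hx⟩, rfl⟩
    intro m hm
    have hm' : m - ε m • b a ∈ S := le_comap trivial
    rwa [LinearMap.mem_ker.1 hm, zero_smul, sub_zero] at hm'

/-- The basis `x ↦ b x - b a`, for `x ≠ a`, of the kernel of the functional that is `1` on the
basis `b`. -/
def kerBasis (a : X) : Module.Basis {x // x ≠ a} k (LinearMap.ker ε) :=
  (Module.Basis.span (v := fun x : {x // x ≠ a} => b x - b a)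
    ((affineIndependent_iff_linearIndependent_vsub k b a).1
      b.linearIndependent.affineIndependent)).map
    (LinearEquiv.ofEq _ _ (span_basis_sub_eq_ker b hε a))

theorem coe_kerBasis (a : X) (x : {x // x ≠ a}) : (kerBasis b hε a x : M) = b x - b a := by
  rw [kerBasis, Module.Basis.map_apply, LinearEquiv.coe_ofEq_apply, Module.Basis.span_apply]

end KernelBasis

section CupMultiples

variable {k G : Type u} [CommRing k] [Group G] {X J N N' A : Rep.{u} k G} {p q r n : ℕ}

theorem partialProd_last_add (x : Fin (p + q) → G) :
    Fin.partialProd x (Fin.last (p + q)) =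
      Fin.partialProd (x ∘ Fin.castAdd q) (Fin.last p) *
        Fin.partialProd (x ∘ Fin.natAdd p) (Fin.last q) := by
  have partialProd_last : ∀ {m : ℕ} (y : Fin m → G),
      Fin.partialProd y (Fin.last m) = (List.ofFn y).prod := fun y => by
    rw [Fin.partialProd, Fin.val_last, List.take_of_length_le (List.length_ofFn).le]
  rw [partialProd_last, partialProd_last, partialProd_last, List.ofFn_add, List.prod_append]
  rfl

/-- The cup product of cochains followed by a pairing of the coefficients. -/
def pairCochain (f : X ⊗ N ⟶ A) (v : (Fin p → G) → X) (y : (Fin r → G) → N) :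
    (Fin (p + r) → G) → A :=
  fun x => f.hom (cupCochain v y x)

variable (f : X ⊗ N ⟶ A)

theorem pairCochain_zero_left (y : (Fin r → G) → N) :
    pairCochain f (0 : (Fin p → G) → X) y = 0 :=
  funext fun x => (congrArg _ (cupCochain_zero_left y x)).trans (map_zero f.hom)

theorem pairCochain_zero_right (v : (Fin p → G) → X) :
    pairCochain f v (0 : (Fin r → G) → N) = 0 :=
  funext fun x => (congrArg _ (cupCochain_zero_right v x)).trans (map_zero f.hom)

theorem pairCochain_sub_right (v : (Fin p → G) → X) (y y' : (Fin r → G) → N) :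
    pairCochain f v (y - y') = pairCochain f v y - pairCochain f v y' := by
  funext x
  change f.hom (_ ⊗ₜ[k] N.ρ _ (_ - _)) = f.hom _ - f.hom _
  rw [map_sub, TensorProduct.tmul_sub]
  exact map_sub f.hom _ _

theorem d_pairCochain (v : (Fin p → G) → X) (y : (Fin r → G) → N) (x : Fin (p + r + 1) → G) :
    inhomogeneousCochains.d A (p + r) (pairCochain f v y) x =
      pairCochain f (inhomogeneousCochains.d _ p v) y (x ∘ Fin.cast (by omega)) +
        (-1 : k) ^ p • pairCochain (r := r + 1) f v (inhomogeneousCochains.d _ r y) x := by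
  refine (congrFun (d_comp_hom f (cupCochain v y)) x).trans ?_
  rw [cupCochain_d, map_add, map_smul]
  rfl

theorem pairCochain_mem_coboundaries_left {v : (Fin p → G) → X} (hv : v ∈ coboundaries X p)
    {y : (Fin r → G) → N} (hy : inhomogeneousCochains.d _ r y = 0) :
    pairCochain f v y ∈ coboundaries A (p + r) := by
  cases p with
  | zero =>
    obtain rfl : v = 0 := hv
    rw [pairCochain_zero_left]
    exact zero_mem _
  | succ p =>
    obtain ⟨h, rfl⟩ := hv
    rw [← comp_cast_mem_coboundaries (show p + 1 + r = p + r + 1 by omega)]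
    refine ⟨pairCochain f h y, funext fun x => (d_pairCochain f h y x).trans ?_⟩
    rw [hy, pairCochain_zero_right, Pi.zero_apply, smul_zero, add_zero]

theorem pairCochain_mem_coboundaries_right {v : (Fin p → G) → X}
    (hv : inhomogeneousCochains.d _ p v = 0) {y : (Fin r → G) → N} (hy : y ∈ coboundaries N r) :
    pairCochain f v y ∈ coboundaries A (p + r) := by
  cases r with
  | zero =>
    obtain rfl : y = 0 := hy
    rw [pairCochain_zero_right]
    exact zero_mem _
  | succ r =>
    obtain ⟨h, rfl⟩ := hy
    refine ⟨(-1 : k) ^ p • pairCochain f v h, ?_⟩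
    rw [map_smul]
    funext x
    change (-1 : k) ^ p • inhomogeneousCochains.d A (p + r) (pairCochain f v h) x = _
    rw [d_pairCochain, hv, pairCochain_zero_left, Pi.zero_apply, zero_add, smul_smul, ← mul_pow,
      neg_one_mul, neg_neg, one_pow, one_smul]

theorem pairCochain_assoc (f' : J ⊗ N' ⟶ N) (v : (Fin p → G) → X) (c : (Fin q → G) → J)
    (y : (Fin r → G) → N') (x : Fin (p + (q + r)) → G) :
    pairCochain f v (pairCochain f' c y) x =
      pairCochain ((α_ X J N').hom ≫ (X ◁ f') ≫ f) (cupCochain v c) y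
        (x ∘ Fin.cast (Nat.add_assoc p q r)) := by
  have head_mul := partialProd_last_add (p := p) (q := q)
    fun i => (x ∘ Fin.cast (Nat.add_assoc p q r)) (Fin.castAdd r i)
  have tail_eq : (fun j => (x ∘ Fin.cast (Nat.add_assoc p q r)) (Fin.natAdd (p + q) j)) =
      fun j => x (Fin.natAdd p (Fin.natAdd q j)) :=
    funext fun j => congrArg x (Fin.ext (Nat.add_assoc p q j))
  unfold pairCochain cupCochain
  rw [head_mul, tail_eq, map_mul, ← Rep.hom_comm_apply]
  rfl

/-- The cochain `x` is, modulo coboundaries, the cup product of `v` with an `r`-cocycle with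
values in `N`, followed by a pairing of the coefficients. -/
def IsCupMultiple (v : (Fin p → G) → X) (r : ℕ) (N : Rep.{u} k G) (x : (Fin n → G) → A) : Prop :=
  ∃ (h : p + r = n) (f : X ⊗ N ⟶ A) (y : (Fin r → G) → N),
    inhomogeneousCochains.d N r y = 0 ∧
      x - (fun z => pairCochain f v y (z ∘ Fin.cast h)) ∈ coboundaries A n

namespace IsCupMultiple

variable {v : (Fin p → G) → X} {c : (Fin q → G) → J} {x : (Fin n → G) → A} {s : ℕ}

theorem mem_coboundaries (hx : IsCupMultiple v r N x) (hv : v ∈ coboundaries X p) :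
    x ∈ coboundaries A n := by
  obtain ⟨h, f, y, hy, hxy⟩ := hx
  have := (comp_cast_mem_coboundaries h).2 (pairCochain_mem_coboundaries_left f hv hy)
  exact (Submodule.sub_mem_iff_left _ this).1 hxy

theorem trans (hx : IsCupMultiple v s N x) (hv : inhomogeneousCochains.d _ p v = 0)
    (hN : ∀ y : (Fin s → G) → N, inhomogeneousCochains.d _ s y = 0 → IsCupMultiple c r N' y) :
    IsCupMultiple (cupCochain v c) r N' x := by
  obtain ⟨rfl, f, y, hy, (hxy : x - pairCochain f v y ∈ coboundaries A _)⟩ := hx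
  obtain ⟨rfl, f', y', hy', (hyy' : y - pairCochain f' c y' ∈ coboundaries N _)⟩ := hN y hy
  refine ⟨Nat.add_assoc p q r, (α_ X J N').hom ≫ (X ◁ f') ≫ f, y', hy', ?_⟩
  have hyf := pairCochain_mem_coboundaries_right f hv hyy'
  rw [pairCochain_sub_right] at hyf
  have hxf := add_mem hxy hyf
  rwa [sub_add_sub_cancel, funext (pairCochain_assoc f f' v c y')] at hxf

end IsCupMultiple

theorem isCupMultiple_one (x : (Fin n → G) → A) (hx : inhomogeneousCochains.d A n x = 0) :
    IsCupMultiple (X := 𝟙_ (Rep.{u} k G)) (fun _ : Fin 0 → G => (1 : k)) n A x := by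
  have one_cup : (fun z => pairCochain (X := 𝟙_ (Rep.{u} k G)) (λ_ A).hom
      (fun _ : Fin 0 → G => (1 : k)) x (z ∘ Fin.cast (Nat.zero_add n))) = x := funext fun z => by
    have tail_eq : (fun j => (z ∘ Fin.cast (Nat.zero_add n)) (Fin.natAdd 0 j)) = z :=
      funext fun j => congrArg z (Fin.ext (Nat.zero_add _))
    change (1 : k) • A.ρ (Fin.partialProd _ 0) (x _) = x z
    rw [tail_eq, Fin.partialProd_zero, one_smul, map_one]
    rfl
  refine ⟨Nat.zero_add n, (λ_ A).hom, x, hx, ?_⟩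
  rw [one_cup, sub_self]
  exact zero_mem _

end CupMultiples

section DimensionShifting

variable {k G : Type u} [CommRing k] [Group G] {P J N : Rep.{u} k G} {r : ℕ}

/-- The pairing `(p, φ) ↦ φ p` of `P` with `Hom(P, N)`, as a linear map in each variable. -/
def ihomApply (P N : Rep.{u} k G) : P →ₗ[k] (Rep.ihom P).obj N →ₗ[k] N :=
  LinearMap.applyₗ (R := k) (M := P) (M₂ := N)

/-- The pairing `(p, φ) ↦ φ p` of `P` with `Hom(P, N)`, as a map of representations. -/
def ihomEval (P N : Rep.{u} k G) : P ⊗ (Rep.ihom P).obj N ⟶ N :=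
  (Rep.tensorHomEquiv P _ N).symm (𝟙 _)

theorem ihomEval_tmul (p : P) (φ : (Rep.ihom P).obj N) :
    (ihomEval P N).hom (p ⊗ₜ[k] φ) = ihomApply P N p φ :=
  rfl

theorem ihomApply_ρ (g : G) (p : P) (φ : (Rep.ihom P).obj N) :
    ihomApply P N (P.ρ g p) (((Rep.ihom P).obj N).ρ g φ) = N.ρ g (ihomApply P N p φ) :=
  Rep.hom_comm_apply (ihomEval P N) g (p ⊗ₜ[k] φ)

theorem d_ihomApply (F : (Fin r → G) → (Rep.ihom P).obj N) (e : P) (z : Fin (r + 1) → G) :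
    inhomogeneousCochains.d N r (fun y => ihomApply P N e (F y)) z =
      ihomApply P N e (inhomogeneousCochains.d _ r F z) +
        ihomApply P N (P.ρ (z 0) e - e) (((Rep.ihom P).obj N).ρ (z 0) (F fun i => z i.succ)) := by
  rw [inhomogeneousCochains.d_hom_apply, inhomogeneousCochains.d_hom_apply, map_add, map_sum,
    map_sub, LinearMap.sub_apply, ihomApply_ρ]
  simp only [map_smul]
  abel

theorem pairCochain_ihomEval (c : (Fin 1 → G) → J) (y : (Fin r → G) → (Rep.ihom J).obj N)
    (z : Fin (r + 1) → G) :
    pairCochain (ihomEval J N) c y (z ∘ Fin.cast (Nat.add_comm 1 r)) =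
      ihomApply J N (c fun _ => z 0) (((Rep.ihom J).obj N).ρ (z 0) (y fun i => z i.succ)) := by
  have head_eq : (fun i => (z ∘ Fin.cast (Nat.add_comm 1 r)) (Fin.castAdd r i)) =
      fun _ : Fin 1 => z 0 := funext fun i => congrArg z (Fin.ext (Fin.val_eq_zero i))
  have tail_eq : (fun i => (z ∘ Fin.cast (Nat.add_comm 1 r)) (Fin.natAdd 1 i)) =
      fun i : Fin r => z i.succ := funext fun i => congrArg z (Fin.ext (Nat.add_comm 1 i))
  have prod_eq : Fin.partialProd (fun _ : Fin 1 => z 0) (Fin.last 1) = z 0 := by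
    rw [← Fin.succ_last, Fin.partialProd_succ, Fin.last_zero, Fin.castSucc_zero,
      Fin.partialProd_zero, one_mul]
  unfold pairCochain cupCochain
  rw [head_eq, tail_eq, prod_eq, ihomEval_tmul]

theorem isCupMultiple_of_isZero_ihom (ι : J ⟶ P) (ε : P ⟶ 𝟙_ (Rep.{u} k G)) (hι : ι ≫ ε = 0)
    {e : P} (he : ε.hom e = (1 : k)) {c : (Fin 1 → G) → J}
    (hc : ∀ g, ι.hom (c g) = P.ρ (g 0) e - e)
    (hN : IsZero (groupCohomology ((Rep.ihom P).obj N) (r + 1)))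
    (x : (Fin (r + 1) → G) → N) (hx : inhomogeneousCochains.d N (r + 1) x = 0) :
    IsCupMultiple c r ((Rep.ihom J).obj N) x := by
  let η : N ⟶ (Rep.ihom P).obj N := Rep.tensorHomEquiv P N N ((ε ▷ N) ≫ (λ_ N).hom)
  let res : (Rep.ihom P).obj N ⟶ (Rep.ihom J).obj N :=
    Rep.tensorHomEquiv J _ N ((ι ▷ _) ≫ ihomEval P N)
  have apply_η : ∀ n, ihomApply P N e (η.hom n) = n := fun n => by
    change (ε.hom e : k) • n = n
    rw [he, one_smul]
  have res_η : ∀ n, res.hom (η.hom n) = 0 := fun n => LinearMap.ext fun j => by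
    change ((ι ≫ ε).hom j : k) • n = 0
    rw [hι]
    exact zero_smul k n
  have apply_res : ∀ j φ, ihomApply J N j (res.hom φ) = ihomApply P N (ι.hom j) φ :=
    fun _ _ => rfl
  obtain ⟨F, hF⟩ := isZero_groupCohomology_iff.1 hN (fun z => η.hom (x z)) (by
    rw [d_comp_hom, hx]
    exact funext fun _ => map_zero η.hom)
  refine ⟨Nat.add_comm 1 r, ihomEval J N, fun y => res.hom (-F y), ?_,
    fun y => ihomApply P N e (F y), funext fun z => ?_⟩
  · refine (d_comp_hom res (-F)).trans ?_
    rw [map_neg, hF]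
    exact funext fun z => (map_neg res.hom _).trans (neg_eq_zero.2 (res_η _))
  · refine (d_ihomApply F e z).trans ?_
    rw [congrFun hF z, apply_η, Pi.sub_apply, pairCochain_ihomEval, ← Rep.hom_comm_apply,
      apply_res, hc, map_neg, map_neg, sub_neg_eq_add]

end DimensionShifting

section Power

variable (π : Type) [Group π]

/-- The cocycle representing the power `𝔳ˢ` of the canonical class. -/
def powCochain : (s : ℕ) → (Fin s → π × π) → augIdealPow π s
  | 0 => fun _ => (1 : ℤ)
  | s + 1 => cupCochain (A := augIdealPow π s) (powCochain s) (canonicalCochain π)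

theorem d_powCochain : ∀ s, inhomogeneousCochains.d (augIdealPow π s) s (powCochain π s) = 0
  | 0 => by
    funext x
    rw [inhomogeneousCochains.d_hom_apply]
    change (1 : ℤ) + _ = 0
    rw [Fin.sum_univ_one]
    rfl
  | s + 1 => d_cupCochain_eq_zero (A := augIdealPow π s) _ _ (d_powCochain s) (d_canonicalCochain π)

theorem canonicalClassPow_eq_π_powCochain : ∀ s, canonicalClassPow π s =
    groupCohomology.π (augIdealPow π s) s
      (groupCohomology.cocyclesMk (powCochain π s) (d_powCochain π s))
  | 0 => rfl
  | s + 1 => by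
    refine (congrArg (fun c => cup c (canonicalClass π))
      (canonicalClassPow_eq_π_powCochain s)).trans ?_
    refine (cup_π _ _).trans (congrArg _ (cochain_injective ?_))
    rw [cupCocycle, cochain_mk, cochain_mk, cochain_mk]
    exact (cochain_mk (powCochain π (s + 1)) (d_powCochain π (s + 1))).symm

theorem canonicalClassPow_eq_zero_iff (s : ℕ) :
    canonicalClassPow π s = 0 ↔ powCochain π s ∈ coboundaries (augIdealPow π s) s := by
  rw [canonicalClassPow_eq_π_powCochain, π_eq_zero_iff_mem_coboundaries, cochain_mk]

/-- The augmentation `ℤ[π] → ℤ` as a map of representations. -/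
def augmentationHom : groupRing π ⟶ 𝟙_ (Rep.{0} ℤ (π × π)) :=
  Rep.ofHom ⟨augmentation π, fun x => LinearMap.ext (augmentation_ρ π x)⟩

variable {π} {G : Type} [Group G] (θ : G →* π × π) {A N : Rep.{0} ℤ G} {m n r : ℕ}

theorem isCupMultiple_canonicalCochain_res
    (hN : IsZero (groupCohomology ((Rep.ihom (Rep.res θ (groupRing π))).obj N) (r + 1)))
    (x : (Fin (r + 1) → G) → N) (hx : inhomogeneousCochains.d N (r + 1) x = 0) :
    IsCupMultiple (X := Rep.res θ (augIdeal π)) (fun g => canonicalCochain π (θ ∘ g)) r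
      ((Rep.ihom (Rep.res θ (augIdeal π))).obj N) x := by
  refine isCupMultiple_of_isZero_ihom (J := Rep.res θ (augIdeal π))
    (Rep.resMap θ (Rep.subtype (groupRing π) _ _)) (Rep.resMap θ (augmentationHom π)) ?_
    (e := (MonoidAlgebra.single 1 1 : MonoidAlgebra ℤ π)) ?_ (fun g => ?_) hN x hx
  · ext j
    exact j.2
  · exact MonoidAlgebra.lift_single (1 : π →* ℤ) 1 1
  · refine Eq.trans ?_ (congrArg (· - _) (groupRing_single π (θ (g 0)) 1 1).symm)
    rw [mul_one]
    rfl

theorem powCochain_succ_comp (s : ℕ) :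
    (fun y : Fin (s + 1) → G => powCochain π (s + 1) (θ ∘ y)) =
      cupCochain (A := Rep.res θ (augIdealPow π s)) (B := Rep.res θ (augIdeal π))
        (fun y => powCochain π s (θ ∘ y)) (fun y => canonicalCochain π (θ ∘ y)) :=
  funext fun x => (cupCochain_res θ (powCochain π s) (canonicalCochain π) x).symm

theorem d_powCochain_comp (s : ℕ) :
    inhomogeneousCochains.d (Rep.res θ (augIdealPow π s)) s (fun y => powCochain π s (θ ∘ y)) =
      0 := by
  rw [d_res, d_powCochain]
  rfl

theorem IsCupMultiple.powCochain_succ {s : ℕ} {x : (Fin n → G) → A}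
    (hx : IsCupMultiple (X := Rep.res θ (augIdealPow π s)) (fun y => powCochain π s (θ ∘ y))
      (r + 1) N x)
    (hN : IsZero (groupCohomology ((Rep.ihom (Rep.res θ (groupRing π))).obj N) (r + 1))) :
    IsCupMultiple (X := Rep.res θ (augIdealPow π (s + 1))) (fun y => powCochain π (s + 1) (θ ∘ y))
      r ((Rep.ihom (Rep.res θ (augIdeal π))).obj N) x := by
  rw [powCochain_succ_comp]
  exact hx.trans (d_powCochain_comp θ s) (isCupMultiple_canonicalCochain_res θ hN)

theorem exists_isCupMultiple_powCochain_succ {x : (Fin n → G) → A}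
    (hx : inhomogeneousCochains.d A n x = 0)
    (hA : IsZero (groupCohomology ((Rep.ihom (Rep.res θ (groupRing π))).obj A) n))
    (hJ : ∀ s, s < m + 1 → ∀ N, IsZero (groupCohomology ((Rep.ihom (Rep.res θ (groupRing π))).obj
      ((Rep.ihom (Rep.res θ (augIdeal π))).obj N)) (n - s))) (hm : m < n) :
    ∃ N, IsCupMultiple (X := Rep.res θ (augIdealPow π (m + 1)))
      (fun y => powCochain π (m + 1) (θ ∘ y)) (n - (m + 1))
        ((Rep.ihom (Rep.res θ (augIdeal π))).obj N) x := by
  induction m with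
  | zero =>
    obtain ⟨n, rfl⟩ := Nat.exists_eq_add_one_of_ne_zero hm.ne'
    exact ⟨A, (isCupMultiple_one x hx).powCochain_succ θ hA⟩
  | succ m ih =>
    obtain ⟨r, hr⟩ : ∃ r, n - (m + 1) = r + 1 := ⟨n - (m + 2), by omega⟩
    obtain ⟨N, hN⟩ := ih (fun s hs => hJ s (by omega)) (by omega)
    have hJN := hJ (m + 1) (by omega) N
    rw [hr] at hN hJN
    rw [show n - (m + 1 + 1) = r by omega]
    exact ⟨_, hN.powCochain_succ θ hJN⟩

theorem isZero_groupCohomology_of_powCochain_res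
    (hpow : (fun y => powCochain π m (θ ∘ y)) ∈ coboundaries (Rep.res θ (augIdealPow π m)) m)
    (hm : m ≤ n)
    (hA : IsZero (groupCohomology ((Rep.ihom (Rep.res θ (groupRing π))).obj A) n))
    (hJ : ∀ s, s < m → ∀ N, IsZero (groupCohomology ((Rep.ihom (Rep.res θ (groupRing π))).obj
      ((Rep.ihom (Rep.res θ (augIdeal π))).obj N)) (n - s))) :
    IsZero (groupCohomology A n) := by
  refine isZero_groupCohomology_iff.2 fun x hx => ?_
  cases m with
  | zero => exact absurd (congrFun hpow Fin.elim0) (one_ne_zero (α := ℤ))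
  | succ m =>
    obtain ⟨N, hN⟩ := exists_isCupMultiple_powCochain_succ θ hx hA hJ hm
    exact hN.mem_coboundaries hpow

end Power

section Dimension

variable {G H : Type} [Group G] [Group H]

theorem isZero_groupCohomology_of_cd_lt {n : ℕ} (h : cd G < n) (A : Rep.{0} ℤ G) :
    IsZero (groupCohomology A n) := by
  rw [ModuleCat.isZero_iff_subsingleton]
  by_contra hA
  have le_cd : (n : ℕ∞) ≤ cd G := le_sSup ⟨n, rfl, A, not_subsingleton_iff_nontrivial.1 hA⟩
  exact le_cd.not_gt h

theorem cd_le {d : ℕ∞} (h : ∀ n : ℕ, d < n → ∀ A : Rep.{0} ℤ G, IsZero (groupCohomology A n)) :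
    cd G ≤ d := by
  refine sSup_le ?_
  rintro _ ⟨n, rfl, A, hA⟩
  by_contra! hn
  exact not_subsingleton_iff_nontrivial.2 hA (ModuleCat.subsingleton_of_isZero (h n hn A))

theorem cd_subgroup_le (S : Subgroup G) : cd S ≤ cd G :=
  cd_le fun n hn A =>
    (isZero_groupCohomology_of_cd_lt hn _).of_iso (groupCohomology.coindIso A n).symm

theorem cd_le_of_mulEquiv (e : G ≃* H) : cd G ≤ cd H :=
  cd_le fun _ hn A =>
    isZero_groupCohomology_of_mulEquiv e A (isZero_groupCohomology_of_cd_lt hn _)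

theorem cd_le_of_injective {f : G →* H} (hf : Function.Injective f) : cd G ≤ cd H :=
  (cd_le_of_mulEquiv (f.ofInjective hf)).trans (cd_subgroup_le f.range)

end Dimension

section TwoSidedStabilizers

variable {π : Type} [Group π]

/-- The stabiliser of `a` for the action `(g, h) • a = g a h⁻¹`, a conjugate of the diagonal. -/
def twoSidedStabilizer (a : π) : Subgroup (π × π) :=
  letI := twoSidedAction π
  MulAction.stabilizer (π × π) a

theorem mem_twoSidedStabilizer {a : π} {x : π × π} :
    x ∈ twoSidedStabilizer a ↔ x.1 * a = a * x.2 :=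
  mul_inv_eq_iff_eq_mul

theorem cd_twoSidedStabilizer_le (a : π) : cd (twoSidedStabilizer a) ≤ cd π := by
  refine cd_le_of_injective (f := (MonoidHom.snd π π).comp (Subgroup.subtype _))
    ((injective_iff_map_eq_one _).2 fun x (hx : x.1.2 = 1) => Subtype.ext (Prod.ext ?_ hx))
  have fst_mul := mem_twoSidedStabilizer.1 x.2
  rwa [hx, mul_one, mul_eq_right] at fst_mul

theorem fst_mem_centralizer {a b : π} {x : π × π}
    (hx : x ∈ twoSidedStabilizer a ⊓ twoSidedStabilizer b) :
    x.1 ∈ Subgroup.centralizer {b * a⁻¹} := by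
  have conj_snd : a * x.2 * a⁻¹ = x.1 :=
    mul_inv_eq_of_eq_mul (mem_twoSidedStabilizer.1 hx.1).symm
  rw [Subgroup.mem_centralizer_singleton_iff, ← mul_assoc, mem_twoSidedStabilizer.1 hx.2,
    ← conj_snd]
  group

theorem cd_inf_twoSidedStabilizer_le (a b : π) :
    cd ↥(twoSidedStabilizer a ⊓ twoSidedStabilizer b) ≤
      cd (Subgroup.centralizer ({b * a⁻¹} : Set π)) := by
  refine cd_le_of_injective
    (f := ((MonoidHom.fst π π).comp (Subgroup.subtype _)).codRestrict _
      fun x => fst_mem_centralizer x.2)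
    ((injective_iff_map_eq_one _).2 fun x hx => ?_)
  have fst_eq : x.1.1 = 1 := congrArg Subtype.val hx
  have mul_snd := mem_twoSidedStabilizer.1 x.2.1
  rw [fst_eq, one_mul, left_eq_mul] at mul_snd
  exact Subtype.ext (Prod.ext fst_eq mul_snd)

theorem groupRing_basis (x : π × π) (a : π) :
    (groupRing π).ρ x (MonoidAlgebra.basis π ℤ a) =
      MonoidAlgebra.basis π ℤ (x.1 * a * x.2⁻¹) := by
  rw [MonoidAlgebra.basis_apply, MonoidAlgebra.basis_apply, groupRing_single]

theorem augmentation_basis (a : π) : augmentation π (MonoidAlgebra.basis π ℤ a) = 1 := by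
  rw [MonoidAlgebra.basis_apply]
  exact MonoidAlgebra.lift_single (1 : π →* ℤ) a 1

variable {G : Type} [Group G] (θ : G →* π × π) {n : ℕ}

theorem isZero_groupCohomology_ihom_groupRing {N : Rep.{0} ℤ G}
    (h : ∀ a, cd ((twoSidedStabilizer a).comap θ) < n) :
    IsZero (groupCohomology ((Rep.ihom (Rep.res θ (groupRing π))).obj N) n) := by
  let _ := twoSidedAction π
  let _ : MulAction G π := MulAction.compHom π θ
  exact isZero_groupCohomology_ihom (P := Rep.res θ (groupRing π)) (MonoidAlgebra.basis π ℤ)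
    (fun g => groupRing_basis (θ g)) fun a => isZero_groupCohomology_of_cd_lt (h a) _

theorem isZero_groupCohomology_ihom_groupRing_ihom_augIdeal {N : Rep.{0} ℤ G}
    (h : ∀ a b, b ≠ a → cd ((twoSidedStabilizer a ⊓ twoSidedStabilizer b).comap θ) < n) :
    IsZero (groupCohomology ((Rep.ihom (Rep.res θ (groupRing π))).obj
      ((Rep.ihom (Rep.res θ (augIdeal π))).obj N)) n) := by
  let _ := twoSidedAction π
  let _ : MulAction G π := MulAction.compHom π θ
  refine isZero_groupCohomology_ihom_ihom (P := Rep.res θ (groupRing π))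
    (J := Rep.res θ (augIdeal π)) (MonoidAlgebra.basis π ℤ)
    (fun g => groupRing_basis (θ g)) (kerBasis _ augmentation_basis)
    (fun g p => Subtype.ext ?_) fun p => ?_
  · refine Eq.trans ?_ (coe_kerBasis _ augmentation_basis _ _).symm
    change (groupRing π).ρ (θ g) (kerBasis _ augmentation_basis _ _).1 = _
    rw [coe_kerBasis, map_sub, groupRing_basis, groupRing_basis]
    rfl
  · have stabilizer_eq : MulAction.stabilizer G p =
        (twoSidedStabilizer p.1.1 ⊓ twoSidedStabilizer p.1.2).comap θ := by
      ext g
      exact Subtype.ext_iff.trans Prod.ext_iff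
    rw [stabilizer_eq]
    exact isZero_groupCohomology_of_cd_lt (h _ _ p.2) _

end TwoSidedStabilizers

section Product

variable {G H : Type} [Group G] [Group H]

/-- The homomorphism `(g, h) ↦ (g, 1)`, through which `G × H` acts on `G` by left translation. -/
def fstInl (G H : Type) [Group G] [Group H] : G × H →* G × G :=
  (MonoidHom.inl G G).comp (MonoidHom.fst G H)

theorem cd_comap_fstInl_le (a : G) : cd ((twoSidedStabilizer a).comap (fstInl G H)) ≤ cd H := by
  refine cd_le_of_injective (f := (MonoidHom.snd G H).comp (Subgroup.subtype _))
    ((injective_iff_map_eq_one _).2 fun x hx => Subtype.ext (Prod.ext ?_ hx))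
  have fst_mul : x.1.1 * a = a * 1 := mem_twoSidedStabilizer.1 x.2
  rwa [mul_one, mul_eq_right] at fst_mul

theorem powCochain_comp_fstInl_mem_coboundaries {s : ℕ} (h : cd G < s) :
    (fun y => powCochain G s (fstInl G H ∘ y)) ∈
      coboundaries (Rep.res (fstInl G H) (augIdealPow G s)) s :=
  res_mem_coboundaries (A := Rep.res (MonoidHom.inl G G) (augIdealPow G s)) (MonoidHom.fst G H)
    (isZero_groupCohomology_iff.1 (isZero_groupCohomology_of_cd_lt h _) _
      (d_powCochain_comp (MonoidHom.inl G G) s))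

theorem cd_prod_le : cd (G × H) ≤ cd G + cd H := by
  refine cd_le fun n hn A => ?_
  obtain ⟨d, hd⟩ := ENat.ne_top_iff_exists.1 (ne_top_of_lt (le_self_add.trans_lt hn))
  obtain ⟨e, he⟩ := ENat.ne_top_iff_exists.1 (ne_top_of_lt (le_add_self.trans_lt hn))
  rw [← hd, ← he, ← Nat.cast_add, Nat.cast_lt] at hn
  have isZero_ihom : ∀ r, e < r → ∀ N, IsZero (groupCohomology
      ((Rep.ihom (Rep.res (fstInl G H) (groupRing G))).obj N) r) := fun r hr _ =>
    isZero_groupCohomology_ihom_groupRing _ fun a =>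
      (cd_comap_fstInl_le a).trans_lt (by rwa [← he, Nat.cast_lt])
  have cd_lt : cd G < (d + 1 : ℕ) := by
    rw [← hd, Nat.cast_lt]
    exact d.lt_succ_self
  exact isZero_groupCohomology_of_powCochain_res (fstInl G H)
    (powCochain_comp_fstInl_mem_coboundaries cd_lt) (by omega)
    (isZero_ihom n (by omega) A) fun s hs _ => isZero_ihom (n - s) (by omega) _

end Product

section CyclicGroups

theorem exists_forall_add_one_sub_eq {M : Type*} [AddCommGroup M] (f : ℤ → M) :
    ∃ F : ℤ → M, ∀ i, F (i + 1) - F i = f i := by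
  refine ⟨fun i => i.inductionOn' 0 0 (fun j _ F => F + f j) fun j _ F => F - f (j - 1),
    fun i => ?_⟩
  beta_reduce
  obtain hi | hi := le_or_gt 0 i
  · rw [Int.inductionOn'_add_one hi, add_sub_cancel_left]
  · have pred := Int.inductionOn'_sub_one (z := i + 1) (b := 0) (motive := fun _ => M) (zero := 0)
      (succ := fun j _ F => F + f j) (pred := fun j _ F => F - f (j - 1)) (by omega)
    rw [add_sub_cancel_right] at pred
    rw [pred, sub_sub_cancel]

variable {k : Type} [CommRing k] (N : Rep.{0} k (Multiplicative ℤ))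

/-- The inclusion of the constant functions. -/
def constHom : N ⟶ functionRep (Multiplicative ℤ) N :=
  Rep.ofHom ⟨LinearMap.pi fun _ => LinearMap.id, fun _ => rfl⟩

/-- The difference operator `F ↦ (x ↦ F (x + 1) - F x)`. -/
def differenceHom : functionRep (Multiplicative ℤ) N ⟶ functionRep (Multiplicative ℤ) N :=
  Rep.ofHom ⟨LinearMap.funLeft k N (· * Multiplicative.ofAdd 1) - LinearMap.id, fun g =>
    LinearMap.ext fun F => funext fun x => by
      change N.ρ g (F (g⁻¹ * (x * Multiplicative.ofAdd 1))) - N.ρ g (F (g⁻¹ * x)) =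
        N.ρ g (F (g⁻¹ * x * Multiplicative.ofAdd 1) - F (g⁻¹ * x))
      rw [map_sub, mul_assoc]⟩

theorem constHom_comp_differenceHom : constHom N ≫ differenceHom N = 0 := by
  ext n
  exact funext fun _ => sub_self _

theorem shortExact_constHom_differenceHom :
    (ShortComplex.mk _ _ (constHom_comp_differenceHom N)).ShortExact where
  exact := by
    refine (forget₂ (Rep k (Multiplicative ℤ)) (ModuleCat k)).reflects_exact_of_faithful _
      ((ShortComplex.moduleCat_exact_iff _).2 fun (F : Multiplicative ℤ → N) hF => ?_)
    have periodic : Function.Periodic (F ∘ Multiplicative.ofAdd) 1 := fun i =>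
      sub_eq_zero.1 (congrFun hF (Multiplicative.ofAdd i))
    refine ⟨F 1, funext fun x => ?_⟩
    have periodic_toAdd := (periodic.int_mul x.toAdd).eq
    rw [Int.cast_id, mul_one] at periodic_toAdd
    exact periodic_toAdd.symm
  mono_f := (Rep.mono_iff_injective _).2 fun _ _ h => congrFun h 1
  epi_g := (Rep.epi_iff_surjective _).2 fun f : Multiplicative ℤ → N =>
    let ⟨F, hF⟩ := exists_forall_add_one_sub_eq (f ∘ Multiplicative.ofAdd)
    ⟨F ∘ Multiplicative.toAdd, funext fun x => hF x.toAdd⟩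

theorem isZero_groupCohomology_multiplicative_int (n : ℕ) :
    IsZero (groupCohomology N (n + 2)) := by
  have stabilizer_subsingleton (x : Multiplicative ℤ) :
      Subsingleton (MulAction.stabilizer (Multiplicative ℤ) x) :=
    ⟨fun g h => Subtype.ext ((mul_eq_right.1 g.2).trans (mul_eq_right.1 h.2).symm)⟩
  have isZero_functionRep (i : ℕ) :
      IsZero (groupCohomology (functionRep (Multiplicative ℤ) N) (i + 1)) :=
    isZero_groupCohomology_functionRep N fun _ => isZero_groupCohomology_succ_of_subsingleton _ i
  have := groupCohomology.epi_δ_of_isZero (shortExact_constHom_differenceHom N) (n + 1)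
    (isZero_functionRep (n + 1))
  exact IsZero.of_epi (groupCohomology.δ (shortExact_constHom_differenceHom N) (n + 1) (n + 2) rfl)
    (isZero_functionRep n)

theorem not_isZero_groupCohomology_of_isCyclic {k G : Type u} [CommRing k] [CommGroup G]
    [Fintype G] [IsCyclic G] (hG : ¬ IsUnit (Fintype.card G : k)) {i : ℕ} [NeZero i] (hi : Even i) :
    ¬ IsZero (groupCohomology (Rep.trivial k G k) i) := by
  obtain ⟨g, hg⟩ := IsCyclic.exists_generator (α := G)
  let A := Rep.trivial k G k
  let x : LinearMap.ker (Rep.applyAsHom A g - 𝟙 A).hom.toLinearMap := ⟨(1 : k), by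
    rw [LinearMap.mem_ker, Rep.sub_hom]
    exact sub_self (1 : k)⟩
  intro hA
  have := ModuleCat.subsingleton_of_isZero hA
  obtain ⟨a, ha⟩ := (Rep.FiniteCyclicGroup.groupCohomologyπEven_eq_zero_iff A g hg i hi x).1
    (Subsingleton.elim _ _)
  have card_mul : (Fintype.card G : k) * (a : k) = 1 := by
    rw [← nsmul_eq_mul, ← Finset.card_univ, ← Finset.sum_const]
    refine Eq.trans ?_ ha
    change _ = A.ρ.norm a
    rw [Representation.norm, LinearMap.sum_apply]
    rfl
  exact hG (IsUnit.of_mul_eq_one _ card_mul)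

theorem cd_eq_top_of_isCyclic {G : Type} [Group G] [IsCyclic G] [Finite G] [Nontrivial G] :
    cd G = ⊤ := by
  let _ : CommGroup G := IsCyclic.commGroup
  have := Fintype.ofFinite G
  by_contra hG
  obtain ⟨d, hd⟩ := ENat.ne_top_iff_exists.1 hG
  refine not_isZero_groupCohomology_of_isCyclic (k := ℤ) (G := G) (i := 2 * (d + 1)) ?_
    (even_two_mul _) (isZero_groupCohomology_of_cd_lt ?_ _)
  · rw [Int.isUnit_iff]
    have := Fintype.one_lt_card (α := G)
    omega
  · rw [← hd, Nat.cast_lt]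
    omega

theorem cd_le_one_of_isCyclic {G : Type} [Group G] [IsCyclic G] (hG : cd G ≠ ⊤) : cd G ≤ 1 := by
  refine cd_le fun n hn A => ?_
  obtain ⟨n, rfl⟩ : ∃ m, n = m + 2 := Nat.exists_eq_add_of_le' (by exact_mod_cast hn)
  obtain _ | _ := finite_or_infinite G
  · obtain _ | _ := subsingleton_or_nontrivial G
    · exact isZero_groupCohomology_succ_of_subsingleton A (n + 1)
    · exact absurd cd_eq_top_of_isCyclic hG
  · exact isZero_groupCohomology_of_mulEquiv intCyclicMulEquiv.symm A
      (isZero_groupCohomology_multiplicative_int _ n)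

end CyclicGroups

section CanonicalPower

variable {π : Type} [Group π] {m n : ℕ}

theorem isZero_groupCohomology_of_canonicalClassPow_eq_zero
    (hcentralizer : ∀ g : π, g ≠ 1 → cd (Subgroup.centralizer ({g} : Set π)) ≤ m)
    (hcd : cd π < n) {s : ℕ} (hs : s ≤ n - m) (hpow : canonicalClassPow π s = 0)
    (A : Rep.{0} ℤ (π × π)) : IsZero (groupCohomology A n) := by
  let θ := MonoidHom.id (π × π)
  have powCochain_mem : (fun y => powCochain π s (θ ∘ y)) ∈
      coboundaries (Rep.res θ (augIdealPow π s)) s :=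
    (canonicalClassPow_eq_zero_iff π s).1 hpow
  have isZero_ihom : IsZero (groupCohomology
      ((Rep.ihom (Rep.res θ (groupRing π))).obj A) n) := by
    refine isZero_groupCohomology_ihom_groupRing θ fun a => ?_
    rw [Subgroup.comap_id]
    exact (cd_twoSidedStabilizer_le a).trans_lt hcd
  refine isZero_groupCohomology_of_powCochain_res θ powCochain_mem (by omega)
    isZero_ihom fun i hi _ =>
      isZero_groupCohomology_ihom_groupRing_ihom_augIdeal θ fun a b hab => ?_
  rw [Subgroup.comap_id]
  calc cd ↥(twoSidedStabilizer a ⊓ twoSidedStabilizer b)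
      ≤ cd (Subgroup.centralizer ({b * a⁻¹} : Set π)) := cd_inf_twoSidedStabilizer_le a b
    _ ≤ m := hcentralizer _ (mul_inv_eq_one.not.2 hab)
    _ < (n - i : ℕ) := Nat.cast_lt.2 (by omega)

theorem cd_prod_self_lt_of_canonicalClassPow_eq_zero
    (hcentralizer : ∀ g : π, g ≠ 1 → cd (Subgroup.centralizer ({g} : Set π)) ≤ m)
    (hcd : cd π < n) (hpow : canonicalClassPow π (n - m) = 0) : cd (π × π) < n := by
  obtain ⟨d, rfl⟩ := Nat.exists_eq_add_one.2 (Nat.cast_pos.1 (zero_le.trans_lt hcd))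
  refine (cd_le fun r hr A => ?_).trans_lt (Nat.cast_lt.2 d.lt_succ_self)
  rw [Nat.cast_lt] at hr
  exact isZero_groupCohomology_of_canonicalClassPow_eq_zero hcentralizer
    (hcd.trans_le (Nat.cast_le.2 hr)) (Nat.sub_le_sub_right hr m) hpow A

end CanonicalPower

end CanonicalClass

end

theorem theorem4_general (π : Type) [Group π] (m : ℕ)
    (hcentraliser : ∀ g : π, g ≠ 1 →
      CanonicalClass.cd (Subgroup.centralizer ({g} : Set π)) ≤ m)
    (hcd : CanonicalClass.cd π < CanonicalClass.cd (π × π)) :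
    ∃ n : ℕ, CanonicalClass.cd (π × π) = n ∧ CanonicalClass.canonicalClassPow π (n - m) ≠ 0 := by
  have cd_prod_ne_top : CanonicalClass.cd (π × π) ≠ ⊤ :=
    ne_top_of_le_ne_top (WithTop.add_ne_top.2 ⟨hcd.ne_top, hcd.ne_top⟩) CanonicalClass.cd_prod_le
  obtain ⟨n, hn⟩ := ENat.ne_top_iff_exists.1 cd_prod_ne_top
  refine ⟨n, hn.symm, fun pow_eq_zero => ?_⟩
  have cd_prod_lt : CanonicalClass.cd (π × π) < n :=
    CanonicalClass.cd_prod_self_lt_of_canonicalClassPow_eq_zero hcentraliser (hn ▸ hcd) pow_eq_zero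
  exact cd_prod_lt.ne hn.symm

theorem theorem4 (π : Type) [Group π]
    (hcentraliser : ∀ g : π, g ≠ 1 → IsCyclic (Subgroup.centralizer ({g} : Set π)))
    (hcd : CanonicalClass.cd π < CanonicalClass.cd (π × π)) :
    ∃ n : ℕ, CanonicalClass.cd (π × π) = n ∧ CanonicalClass.canonicalClassPow π (n - 1) ≠ 0 :=
  theorem4_general π 1 (fun g hg =>
    have := hcentraliser g hg
    CanonicalClass.cd_le_one_of_isCyclic
      (ne_top_of_le_ne_top hcd.ne_top (CanonicalClass.cd_subgroup_le _))) hcd
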